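/- Let $(\Omega,\mathcal F,\mathbb P)$ be a probability space, $T>0$, and let $(\mathcal F_t)_{0\le t\le T}$ be a filtration of sub-$\sigma$-algebras of $\mathcal F$ (not necessarily satisfying the usual assumptions) such that $\mathcal F_0$ is trivial ($\mathbb P[A]\in\{0,1\}$ for all $A\in\mathcal F_0$) and $\mathcal F_T$ is generated by $\bigcup_{0\le t<T}\mathcal F_t$. Write $L^\infty(\mathcal F_t)$ for the space of bounded $\mathcal F_t$-measurable random variables modulo $\mathbb P$-a.s. equality; all (in)equalities below are understood $\mathbb P$-a.s., and $L^\infty(\mathcal F_0)$ is identified with $\mathbb R$. Let $u_{t,s}\colon L^\infty(\mathcal F_s)\to L^\infty(\mathcal F_t)$, $0\le t\le s\le T$, be a family of coherent utility functions, that is, for all $\xi,\eta\in L^\infty(\mathcal F_s)$: 1. $u_{t,s}(0)=0$, and $\xi\ge 0$ implies $u_{t,s}(\xi)\ge 0$; 2. $u_{t,s}(\lambda\xi+(1-\lambda)\eta)\ge\lambda u_{t,s}(\xi)+(1-\lambda)u_{t,s}(\eta)$ for every $\mathcal F_t$-measurable $\lambda$ with $0\le\lambda\le 1$; 3. $u_{t,s}(\lambda\xi)=\lambda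 u_{t,s}(\xi)$ for every $\lambda\in L^\infty(\mathcal F_t)$ with $\lambda\ge0$; 4. $u_{t,s}(\xi+a)=u_{t,s}(\xi)+a$ for every $a\in L^\infty(\mathcal F_t)$. Assume that the family is time consistent: $u_{t,v}=u_{t,s}\circ u_{s,v}$ for $0\le t\le s\le v\le T$. Assume that for every $0\le t<T$ the $\sigma$-algebra $\mathcal F_T$ is atomless conditionally to $\mathcal F_t$: for every $A\in\mathcal F_T$ there is $B\in\mathcal F_T$, $B\subset A$, such that $0<\mathbb E[\mathbf 1_B\mid\mathcal F_t]<\mathbb E[\mathbf 1_A\mid\mathcal F_t]$ a.s. on $\{\mathbb E[\mathbf 1_A\mid\mathcal F_t]>0\}$. Suppose finally that $u_{0,T}$ is - relevant: $u_{0,T}(-\mathbf 1_A)<0$ for every $A\in\mathcal F_T$ with $\mathbb P[A]>0$; - Lebesgue continuous: if $(\xi_n)$ is a uniformly bounded sequence in $L^\infty(\mathcal F_T)$ that converges in probability to $\eta\in L^\infty(\mathcal F_T)$, then $u_{0,T}(\xi_n)\to u_{0,T}(\eta)$; - commonotone: $u_{0,T}(\xi+\eta)=u_{0,T}(\xi)+u_{0,T}(\eta)$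 whenever $\xi,\eta\in L^\infty(\mathcal F_T)$ are commonotone, i.e. $\xi=f(\zeta)$ and $\eta=g(\zeta)$ a.s. for some $\mathcal F_T$-measurable random variable $\zeta$ and nondecreasing $f,g\colon\mathbb R\to\mathbb R$. Then there is a probability measure $\mathbb Q\sim\mathbb P$ such that $u_{0,T}(\xi)=\mathbb E_{\mathbb Q}[\xi]$ for all $\xi\in L^\infty(\mathcal F_T)$. -/

import Mathlib

open MeasureTheory ProbabilityTheory Filter
open scoped ENNReal Topology

/-- `L^∞(m)` for a sub-σ-algebra `m`: the classes in `L^∞(P)` that have an `m`-measurable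
representative. All these spaces are subspaces of the same space `L^∞(P)`. -/
noncomputable abbrev LInfty {Ω : Type*} {m₀ : MeasurableSpace Ω} (P : Measure Ω) (m : MeasurableSpace Ω) :
    Submodule ℝ (Lp ℝ ∞ P) :=
  @lpMeas Ω ℝ ℝ _ _ _ m m₀ ∞ P

/-- `m₂` is atomless conditionally to `m₁`: every `A ∈ m₂` has a subset `B ∈ m₂` such that
`0 < E[1_B | m₁] < E[1_A | m₁]` almost surely on `{E[1_A | m₁] > 0}`. -/
def CondAtomless {Ω : Type*} {m₀ : MeasurableSpace Ω} (P : Measure Ω)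
    (m₁ m₂ : MeasurableSpace Ω) : Prop :=
  ∀ A : Set Ω, MeasurableSet[m₂] A → ∃ B : Set Ω, B ⊆ A ∧ MeasurableSet[m₂] B ∧
    ∀ᵐ ω ∂P, 0 < (P⟦A|m₁⟧) ω → 0 < (P⟦B|m₁⟧) ω ∧ (P⟦B|m₁⟧) ω < (P⟦A|m₁⟧) ω

/-- `u : L^∞(m₂) → L^∞(m₁)` is a coherent (monetary, concave, positively homogeneous) utility
function. It is used for `m₁ ≤ m₂`. The element `ζ` of `L^∞(m₂)` in a clause is the class
whose value under `u` the clause is about (for example that of `l ξ + (1 - l) η`). -/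
structure IsCoherentUtility {Ω : Type*} {m₀ : MeasurableSpace Ω} (P : Measure Ω)
    (m₁ m₂ : MeasurableSpace Ω) (u : LInfty P m₂ → LInfty P m₁) : Prop where
  map_zero : u 0 = 0
  nonneg : ∀ ξ : LInfty P m₂, (∀ᵐ ω ∂P, 0 ≤ (ξ : Lp ℝ ∞ P) ω) →
    ∀ᵐ ω ∂P, 0 ≤ (u ξ : Lp ℝ ∞ P) ω
  concave : ∀ (ξ η ζ : LInfty P m₂) (l : LInfty P m₁),
    (∀ᵐ ω ∂P, 0 ≤ (l : Lp ℝ ∞ P) ω ∧ (l : Lp ℝ ∞ P) ω ≤ 1) →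
    (∀ᵐ ω ∂P, (ζ : Lp ℝ ∞ P) ω = (l : Lp ℝ ∞ P) ω * (ξ : Lp ℝ ∞ P) ω
      + (1 - (l : Lp ℝ ∞ P) ω) * (η : Lp ℝ ∞ P) ω) →
    ∀ᵐ ω ∂P, (l : Lp ℝ ∞ P) ω * (u ξ : Lp ℝ ∞ P) ω
      + (1 - (l : Lp ℝ ∞ P) ω) * (u η : Lp ℝ ∞ P) ω ≤ (u ζ : Lp ℝ ∞ P) ω
  pos_homogeneous : ∀ (ξ ζ : LInfty P m₂) (l : LInfty P m₁),
    (∀ᵐ ω ∂P, 0 ≤ (l : Lp ℝ ∞ P) ω) →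
    (∀ᵐ ω ∂P, (ζ : Lp ℝ ∞ P) ω = (l : Lp ℝ ∞ P) ω * (ξ : Lp ℝ ∞ P) ω) →
    ∀ᵐ ω ∂P, (u ζ : Lp ℝ ∞ P) ω = (l : Lp ℝ ∞ P) ω * (u ξ : Lp ℝ ∞ P) ω
  translation : ∀ (ξ ζ : LInfty P m₂) (a : LInfty P m₁),
    (∀ᵐ ω ∂P, (ζ : Lp ℝ ∞ P) ω = (ξ : Lp ℝ ∞ P) ω + (a : Lp ℝ ∞ P) ω) →
    ∀ᵐ ω ∂P, (u ζ : Lp ℝ ∞ P) ω = (u ξ : Lp ℝ ∞ P) ω + (a : Lp ℝ ∞ P) ω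

/-- `u(-1_A) < 0` for every `A ∈ m₂` of positive probability. -/
def IsRelevant {Ω : Type*} {m₀ : MeasurableSpace Ω} (P : Measure Ω)
    (m₁ m₂ : MeasurableSpace Ω) (u : LInfty P m₂ → LInfty P m₁) : Prop :=
  ∀ A : Set Ω, MeasurableSet[m₂] A → 0 < P A → ∀ ξ : LInfty P m₂,
    (∀ᵐ ω ∂P, (ξ : Lp ℝ ∞ P) ω = -(A.indicator (fun _ => (1 : ℝ)) ω)) →
    ∀ᵐ ω ∂P, (u ξ : Lp ℝ ∞ P) ω < 0

/-- `u` is continuous in probability along uniformly bounded sequences. -/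
def IsLebesgueContinuous {Ω : Type*} {m₀ : MeasurableSpace Ω} (P : Measure Ω)
    (m₁ m₂ : MeasurableSpace Ω) (u : LInfty P m₂ → LInfty P m₁) : Prop :=
  ∀ (ξ : ℕ → LInfty P m₂) (η : LInfty P m₂),
    (∃ C : ℝ, ∀ n, ∀ᵐ ω ∂P, |(ξ n : Lp ℝ ∞ P) ω| ≤ C) →
    TendstoInMeasure P (fun n => ((ξ n : Lp ℝ ∞ P) : Ω → ℝ)) atTop (η : Lp ℝ ∞ P) →
    TendstoInMeasure P (fun n => ((u (ξ n) : Lp ℝ ∞ P) : Ω → ℝ)) atTop (u η : Lp ℝ ∞ P)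

/-- `ξ` and `η` are commonotone: almost surely `ξ = f(ζ)` and `η = g(ζ)` for an `m`-measurable
random variable `ζ` and nondecreasing functions `f, g : ℝ → ℝ`. -/
def Commonotone {Ω : Type*} {m₀ : MeasurableSpace Ω} (P : Measure Ω)
    (m : MeasurableSpace Ω) (ξ η : LInfty P m) : Prop :=
  ∃ (f g : ℝ → ℝ) (ζ : Ω → ℝ), Monotone f ∧ Monotone g ∧ Measurable[m] ζ ∧
    (∀ᵐ ω ∂P, (ξ : Lp ℝ ∞ P) ω = f (ζ ω)) ∧ (∀ᵐ ω ∂P, (η : Lp ℝ ∞ P) ω = g (ζ ω))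

/-- `u` is additive on commonotone pairs. -/
def IsCommonotone {Ω : Type*} {m₀ : MeasurableSpace Ω} (P : Measure Ω)
    (m₁ m₂ : MeasurableSpace Ω) (u : LInfty P m₂ → LInfty P m₁) : Prop :=
  ∀ ξ η : LInfty P m₂, Commonotone P m₂ ξ η → u (ξ + η) = u ξ + u η

/-! Let φ = u_{0,T}, real-valued because F_0 is trivial, and v = u_{t,T} with t < T; consistency
gives φ(f) = φ(v f). The heart of the proof is a set E with v(1_E) = 1/2 (`exists_cond_eq_half`).
For A in F_t the sets E ∩ A ⊆ E ∪ Aᶜ are nested, so φ adds their indicators. Applying v inside φ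
replaces 1_E by 1/2 on A: the two values become φ(1_A)/2 and 1/2 + φ(1_{Aᶜ})/2, while the sum
2·1_A·1_E + 1_{Aᶜ} becomes the constant 1. Hence φ(1_A) + φ(1_{Aᶜ}) = 1, that is, φ(1_A) + φ(-1_A) =
0.

E is chosen maximal in probability subject to v(1_E) ≤ 1/2. Where the constraint is slack,
conditional atomlessness provides pieces of Eᶜ so small that adding one would respect the
constraint, against maximality. The limits involved are conditional; `cond_le_of_tendsto` derives
them from continuity and relevance of φ.

A superadditive φ is additive on functions with φ(f) + φ(-f) = 0. Lebesgue continuity carries this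
symmetry from the union of the F_t to F_T and makes A ↦ φ(1_A) countably additive; Radon–Nikodym
gives Q, and relevance its equivalence to P. -/

/-! ### Bounded measurable functions -/

/-- Bounded functions that are measurable for a given σ-algebra. -/
def BddMeas {Ω : Type*} (m : MeasurableSpace Ω) (f : Ω → ℝ) : Prop :=
  Measurable[m] f ∧ ∃ C : ℝ, ∀ ω, |f ω| ≤ C

/-- The real indicator function of a set. -/
noncomputable abbrev ind {Ω : Type*} (A : Set Ω) : Ω → ℝ := A.indicator fun _ => (1 : ℝ)

namespace BddMeas

variable {Ω : Type*} {m m' : MeasurableSpace Ω} {f g : Ω → ℝ} {A : Set Ω}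

lemma mono (h : m ≤ m') (hf : BddMeas m f) : BddMeas m' f := ⟨hf.1.mono h le_rfl, hf.2⟩

lemma const (c : ℝ) : BddMeas m fun _ => c := ⟨@measurable_const _ _ _ m _, |c|, fun _ => le_rfl⟩

lemma add (hf : BddMeas m f) (hg : BddMeas m g) : BddMeas m fun ω => f ω + g ω := by
  obtain ⟨C, hC⟩ := hf.2
  obtain ⟨D, hD⟩ := hg.2
  exact ⟨Measurable.add hf.1 hg.1, C + D,
    fun ω => (abs_add_le _ _).trans (add_le_add (hC ω) (hD ω))⟩

lemma mul (hf : BddMeas m f) (hg : BddMeas m g) : BddMeas m fun ω => f ω * g ω := by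
  obtain ⟨C, hC⟩ := hf.2
  obtain ⟨D, hD⟩ := hg.2
  refine ⟨Measurable.mul hf.1 hg.1, C * D, fun ω => ?_⟩
  rw [abs_mul]
  exact mul_le_mul (hC ω) (hD ω) (abs_nonneg _) ((abs_nonneg _).trans (hC ω))

lemma neg (hf : BddMeas m f) : BddMeas m fun ω => -f ω := by
  simpa using (const (m := m) (-1)).mul hf

lemma sub (hf : BddMeas m f) (hg : BddMeas m g) : BddMeas m fun ω => f ω - g ω := by
  simpa [sub_eq_add_neg] using hf.add hg.neg

lemma ind (hA : MeasurableSet[m] A) : BddMeas m (ind A) := by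
  refine ⟨Measurable.indicator (@measurable_const _ _ _ m _) hA, 1, fun ω => ?_⟩
  by_cases h : ω ∈ A <;> simp [h]

lemma measurableSet_le (hf : BddMeas m f) (hg : BddMeas m g) :
    MeasurableSet[m] {ω | f ω ≤ g ω} := _root_.measurableSet_le hf.1 hg.1

lemma measurableSet_lt (hf : BddMeas m f) (hg : BddMeas m g) :
    MeasurableSet[m] {ω | f ω < g ω} := _root_.measurableSet_lt hf.1 hg.1

lemma integrable {m₀ : MeasurableSpace Ω} {P : Measure Ω} [IsFiniteMeasure P] (hm : m ≤ m₀)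
    (hf : BddMeas m f) : Integrable f P := by
  obtain ⟨C, hC⟩ := hf.2
  exact Integrable.of_bound (hf.1.mono hm le_rfl).aestronglyMeasurable C (ae_of_all _ hC)

end BddMeas

/-! ### Utility operators on bounded measurable functions -/

/-- Coherent conditional utility operators acting on functions instead of classes. -/
structure IsConditionalUtility {Ω : Type*} {m₀ : MeasurableSpace Ω} (P : Measure Ω)
    (m₁ m₂ : MeasurableSpace Ω) (v : (Ω → ℝ) → Ω → ℝ) : Prop where
  bddMeas : ∀ {f}, BddMeas m₂ f → BddMeas m₁ (v f)
  mono : ∀ {f g}, BddMeas m₂ f → BddMeas m₂ g → f ≤ᵐ[P] g → v f ≤ᵐ[P] v g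
  superadd : ∀ {f g}, BddMeas m₂ f → BddMeas m₂ g →
    ∀ᵐ ω ∂P, v f ω + v g ω ≤ v (fun ω => f ω + g ω) ω
  homog : ∀ {l f}, BddMeas m₁ l → BddMeas m₂ f → (∀ ω, 0 ≤ l ω) →
    ∀ᵐ ω ∂P, v (fun ω => l ω * f ω) ω = l ω * v f ω
  translation : ∀ {f a}, BddMeas m₂ f → BddMeas m₁ a →
    ∀ᵐ ω ∂P, v (fun ω => f ω + a ω) ω = v f ω + a ω

/-- Relevant, Lebesgue continuous coherent utility functionals which are additive on pairs of
nested indicators. -/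
structure IsUtilityFunctional {Ω : Type*} {m₀ : MeasurableSpace Ω} (P : Measure Ω)
    (m : MeasurableSpace Ω) (φ : (Ω → ℝ) → ℝ) : Prop where
  mono : ∀ {f g}, BddMeas m f → BddMeas m g → f ≤ᵐ[P] g → φ f ≤ φ g
  superadd : ∀ {f g}, BddMeas m f → BddMeas m g → φ f + φ g ≤ φ (fun ω => f ω + g ω)
  homog : ∀ {c f}, 0 ≤ c → BddMeas m f → φ (fun ω => c * f ω) = c * φ f
  translation : ∀ {f} (a : ℝ), BddMeas m f → φ (fun ω => f ω + a) = φ f + a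
  relevant : ∀ {A}, MeasurableSet[m] A → 0 < P A → φ (fun ω => -ind A ω) < 0
  lebesgue : ∀ {f : ℕ → Ω → ℝ} {g}, (∀ n, BddMeas m (f n)) → BddMeas m g →
    (∃ C : ℝ, ∀ n ω, |f n ω| ≤ C) → (∀ᵐ ω ∂P, Tendsto (fun n => f n ω) atTop (𝓝 (g ω))) →
    Tendsto (fun n => φ (f n)) atTop (𝓝 (φ g))
  commonotone : ∀ {A B}, MeasurableSet[m] A → MeasurableSet[m] B → A ⊆ B →
    φ (fun ω => ind A ω + ind B ω) = φ (ind A) + φ (ind B)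

namespace IsConditionalUtility

variable {Ω : Type*} {m₀ : MeasurableSpace Ω} {P : Measure Ω}
  {m₁ m₂ : MeasurableSpace Ω} {v : (Ω → ℝ) → Ω → ℝ}
  {f g : Ω → ℝ}

lemma congr (hv : IsConditionalUtility P m₁ m₂ v) (hf : BddMeas m₂ f) (hg : BddMeas m₂ g)
    (h : f =ᵐ[P] g) : v f =ᵐ[P] v g :=
  (hv.mono hf hg h.le).antisymm (hv.mono hg hf h.symm.le)

lemma map_const (hv : IsConditionalUtility P m₁ m₂ v) (c : ℝ) :
    ∀ᵐ ω ∂P, v (fun _ => c) ω = c := by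
  have h0 := hv.homog (BddMeas.const 0) (BddMeas.const 0) (fun _ => le_rfl)
  have h1 := hv.translation (BddMeas.const 0) (BddMeas.const c)
  filter_upwards [h0, h1] with ω h0 h1
  simp_all

/-- Locality: on an `m₁`-measurable set the value only depends on the restriction to that set. -/
lemma local_eq (hv : IsConditionalUtility P m₁ m₂ v) (hm : m₁ ≤ m₂) (hf : BddMeas m₂ f)
    (hg : BddMeas m₂ g) {A : Set Ω} (hA : MeasurableSet[m₁] A)
    (h : ∀ᵐ ω ∂P, ω ∈ A → f ω = g ω) : ∀ᵐ ω ∂P, ω ∈ A → v f ω = v g ω := by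
  have hi := BddMeas.ind hA
  have hi0 : ∀ ω, 0 ≤ ind A ω := fun ω => Set.indicator_nonneg (fun _ _ => zero_le_one) ω
  have h1 := hv.homog hi hf hi0
  have h2 := hv.homog hi hg hi0
  have h3 : v (fun ω => ind A ω * f ω) =ᵐ[P] v (fun ω => ind A ω * g ω) := by
    refine hv.congr ((hi.mono hm).mul hf) ((hi.mono hm).mul hg) ?_
    filter_upwards [h] with ω h
    by_cases hω : ω ∈ A <;> simp [hω, h]
  filter_upwards [h1, h2, h3] with ω h1 h2 h3 hω
  simp_all

end IsConditionalUtility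

namespace IsUtilityFunctional

variable {Ω : Type*} {m₀ : MeasurableSpace Ω} {P : Measure Ω} {m : MeasurableSpace Ω} {φ : (Ω → ℝ) → ℝ}
  {f g : Ω → ℝ}

lemma congr (hφ : IsUtilityFunctional P m φ) (hf : BddMeas m f) (hg : BddMeas m g)
    (h : f =ᵐ[P] g) : φ f = φ g :=
  (hφ.mono hf hg h.le).antisymm (hφ.mono hg hf h.symm.le)

lemma map_const (hφ : IsUtilityFunctional P m φ) (c : ℝ) : φ (fun _ => c) = c := by
  have h0 := hφ.homog le_rfl (BddMeas.const 0)
  have h1 := hφ.translation c (BddMeas.const 0)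
  simp only [zero_mul, zero_add] at h0 h1
  rw [h1, h0, zero_add]

/-- Relevance passes from indicators to nonnegative functions, because f ≥ ε·1_{f ≥ ε}; the levels ε
= 1/(n+1) exhaust {f > 0}. -/
lemma ae_eq_zero_of_nonneg_map_neg (hφ : IsUtilityFunctional P m φ) (hf : BddMeas m f)
    (hf0 : ∀ ω, 0 ≤ f ω) (h : 0 ≤ φ (fun ω => -f ω)) : ∀ᵐ ω ∂P, f ω = 0 := by
  have key : ∀ n : ℕ, P {ω | 1 / ((n : ℝ) + 1) ≤ f ω} = 0 := by
    intro n
    by_contra hn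
    have hA : MeasurableSet[m] {ω | 1 / ((n : ℝ) + 1) ≤ f ω} :=
      (BddMeas.const _).measurableSet_le hf
    have hpos : 0 < 1 / ((n : ℝ) + 1) := by positivity
    have h1 := hφ.relevant hA (pos_iff_ne_zero.2 hn)
    have h2 := hφ.homog hpos.le (BddMeas.ind hA).neg
    have h3 := hφ.mono hf.neg ((BddMeas.const (1 / ((n : ℝ) + 1))).mul (BddMeas.ind hA).neg)
      (ae_of_all _ fun ω => by
        by_cases hω : ω ∈ {ω | 1 / ((n : ℝ) + 1) ≤ f ω}
        · simp only [Set.indicator_of_mem hω]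
          have : 1 / ((n : ℝ) + 1) ≤ f ω := hω
          linarith
        · simp only [Set.indicator_of_notMem hω]
          have := hf0 ω
          linarith)
    have := mul_neg_of_pos_of_neg hpos h1
    linarith
  have hall : ∀ᵐ ω ∂P, ∀ n : ℕ, ¬ (1 / ((n : ℝ) + 1) ≤ f ω) :=
    ae_all_iff.2 fun n => by
      rw [ae_iff]
      simpa using key n
  filter_upwards [hall] with ω hω
  by_contra hne
  obtain ⟨n, hn⟩ := exists_nat_one_div_lt (lt_of_le_of_ne (hf0 ω) (Ne.symm hne))
  exact hω n hn.le

end IsUtilityFunctional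

/-! ### Conditional limits from continuity of φ -/

section Consistent

variable {Ω : Type*} {m₀ : MeasurableSpace Ω} {P : Measure Ω}
  {m₁ m₂ : MeasurableSpace Ω} {v : (Ω → ℝ) → Ω → ℝ} {φ : (Ω → ℝ) → ℝ}

/-- Conditional upper bounds are preserved under bounded almost sure limits. -/
lemma cond_le_of_tendsto (hv : IsConditionalUtility P m₁ m₂ v) (hm : m₁ ≤ m₂)
    (hφ : IsUtilityFunctional P m₂ φ) (hcons : ∀ f, BddMeas m₂ f → φ f = φ (v f))
    {f : ℕ → Ω → ℝ} {g Y : Ω → ℝ} (hf : ∀ n, BddMeas m₂ (f n)) (hg : BddMeas m₂ g)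
    (hb : ∃ C : ℝ, ∀ n ω, |f n ω| ≤ C)
    (hlim : ∀ᵐ ω ∂P, Tendsto (fun n => f n ω) atTop (𝓝 (g ω)))
    (hY : BddMeas m₁ Y) (hle : ∀ n, v (f n) ≤ᵐ[P] Y) : v g ≤ᵐ[P] Y := by
  have hvg := hv.bddMeas hg
  have hA : MeasurableSet[m₁] {ω | Y ω < v g ω} :=
    hY.measurableSet_lt hvg
  -- The set where the bound fails. Testing φ on 1_A (h - v g) gives 0 for h = g, but at most φ(-1_A
  -- (v g - Y)) for h = f n; continuity and relevance then make A null.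
  set A := {ω | Y ω < v g ω}
  have hi := BddMeas.ind hA
  have hi0 : ∀ ω, 0 ≤ ind A ω := fun ω => Set.indicator_nonneg (fun _ _ => zero_le_one) ω
  have hW : BddMeas m₁ (fun ω => ind A ω * (v g ω - Y ω)) := hi.mul (hvg.sub hY)
  have val : ∀ h, BddMeas m₂ h →
      ∀ᵐ ω ∂P, v (fun ω => ind A ω * (h ω + -v g ω)) ω = ind A ω * (v h ω + -v g ω) := by
    intro h hh
    filter_upwards [hv.homog hi (hh.add (hvg.neg.mono hm)) hi0, hv.translation hh hvg.neg]
      with ω h1 h2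
    rw [h1, h2]
  have hz : ∀ h, BddMeas m₂ h → BddMeas m₂ (fun ω => ind A ω * (h ω + -v g ω)) :=
    fun h hh => (hi.mono hm).mul (hh.add (hvg.neg.mono hm))
  have hup : ∀ n, φ (fun ω => ind A ω * (f n ω + -v g ω)) ≤
      φ (fun ω => -(ind A ω * (v g ω - Y ω))) := by
    intro n
    rw [hcons _ (hz _ (hf n))]
    refine hφ.mono ((hv.bddMeas (hz _ (hf n))).mono hm) (hW.neg.mono hm) ?_
    filter_upwards [val _ (hf n), hle n] with ω h1 h2
    rw [h1]
    nlinarith [hi0 ω]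
  have hlimz : φ (fun ω => ind A ω * (g ω + -v g ω)) = 0 := by
    rw [hcons _ (hz _ hg), ← hφ.map_const 0]
    refine hφ.congr ((hv.bddMeas (hz _ hg)).mono hm) (BddMeas.const 0) ?_
    filter_upwards [val _ hg] with ω h1
    rw [h1]
    ring
  have hconv := hφ.lebesgue (fun n => hz _ (hf n)) (hz _ hg) (by
    obtain ⟨C, hC⟩ := hb
    obtain ⟨D, hD⟩ := hvg.2
    refine ⟨C + D, fun n ω => ?_⟩
    have h1 : |f n ω + -v g ω| ≤ C + D :=
      (abs_add_le _ _).trans (add_le_add (hC n ω) (by rw [abs_neg]; exact hD ω))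
    by_cases hω : ω ∈ A
    · simpa [hω] using h1
    · simpa [hω] using (abs_nonneg _).trans h1) (by
    filter_upwards [hlim] with ω h
    exact (h.add_const _).const_mul _)
  rw [hlimz] at hconv
  have h0 := le_of_tendsto' hconv hup
  have hW0 : ∀ ω, 0 ≤ ind A ω * (v g ω - Y ω) := by
    intro ω
    by_cases hω : ω ∈ A
    · simpa [hω] using (show Y ω < v g ω from hω).le
    · simp [hω]
  filter_upwards [hφ.ae_eq_zero_of_nonneg_map_neg (hW.mono hm) hW0 h0] with ω hω
  by_contra hlt
  have hmem : ω ∈ A := not_le.1 hlt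
  simp only [Set.indicator_of_mem hmem, one_mul] at hω
  exact hlt (by linarith)

end Consistent

/-! ### Conditionally small sets and maximal sets -/

section Sets

variable {Ω : Type*} {m₀ : MeasurableSpace Ω} {P : Measure Ω} [IsProbabilityMeasure P]
  {m₁ m₂ : MeasurableSpace Ω}

/-- In a conditionally atomless σ-algebra each set can be halved conditionally. -/
lemma CondAtomless.exists_half (h : CondAtomless P m₁ m₂) (h₁₂ : m₁ ≤ m₂) (h₂ : m₂ ≤ m₀)
    {A : Set Ω} (hA : MeasurableSet[m₂] A) :
    ∃ D ⊆ A, MeasurableSet[m₂] D ∧ P.real D ≤ P.real A / 2 ∧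
      ∀ᵐ ω ∂P, 0 < (P⟦A|m₁⟧) ω → 0 < (P⟦D|m₁⟧) ω := by
  obtain ⟨B, hBA, hB, hlt⟩ := h A hA
  have h₁ : m₁ ≤ m₀ := h₁₂.trans h₂
  have hiA : Integrable (ind A) P := (BddMeas.ind hA).integrable h₂
  have hiB : Integrable (ind B) P := (BddMeas.ind hB).integrable h₂
  have hS : MeasurableSet[m₁] {ω | (P⟦B|m₁⟧) ω ≤ (P⟦A|m₁⟧) ω / 2} :=
    measurableSet_le stronglyMeasurable_condExp.measurable
      (stronglyMeasurable_condExp.measurable.div_const 2)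
  -- Keep the conditionally smaller of B and A \ B: B on S, A \ B off S. Both have positive
  -- conditional probability where A does.
  set S := {ω | (P⟦B|m₁⟧) ω ≤ (P⟦A|m₁⟧) ω / 2}
  have hD : MeasurableSet[m₂] (B ∩ S ∪ (A \ B) ∩ Sᶜ) :=
    (hB.inter (h₁₂ _ hS)).union ((hA.diff hB).inter (h₁₂ _ hS).compl)
  have heq : ind (B ∩ S ∪ (A \ B) ∩ Sᶜ) = S.indicator (ind B) + Sᶜ.indicator (ind A - ind B) := by
    ext ω
    by_cases h1 : ω ∈ B <;> by_cases h2 : ω ∈ S <;> by_cases h3 : ω ∈ A <;>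
      simp [h1, h2, h3]
    exact h3 (hBA h1)
  have hcond : P⟦B ∩ S ∪ (A \ B) ∩ Sᶜ|m₁⟧ =ᵐ[P]
      S.indicator (P⟦B|m₁⟧) + Sᶜ.indicator (P⟦A|m₁⟧ - P⟦B|m₁⟧) := by
    rw [show ((B ∩ S ∪ (A \ B) ∩ Sᶜ).indicator fun _ => (1 : ℝ)) = _ from heq]
    refine (condExp_add (hiB.indicator (h₁ _ hS))
      ((hiA.sub hiB).indicator (h₁ _ hS.compl)) m₁).trans ?_
    refine (condExp_indicator hiB hS).add ((condExp_indicator (hiA.sub hiB) hS.compl).trans ?_)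
    filter_upwards [condExp_sub hiA hiB m₁] with ω hω
    by_cases h2 : ω ∈ Sᶜ
    · simp only [Set.indicator_of_mem h2, hω]
    · simp only [Set.indicator_of_notMem h2]
  have hBnn : 0 ≤ᵐ[P] P⟦B|m₁⟧ :=
    condExp_nonneg (ae_of_all _ fun ω => Set.indicator_nonneg (fun _ _ => zero_le_one) ω)
  have hBle : P⟦B|m₁⟧ ≤ᵐ[P] P⟦A|m₁⟧ :=
    condExp_mono hiB hiA (ae_of_all _ fun ω =>
      Set.indicator_le_indicator_of_subset hBA (fun _ => zero_le_one) ω)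
  refine ⟨B ∩ S ∪ (A \ B) ∩ Sᶜ, ?_, hD, ?_, ?_⟩
  · rintro ω (h | h)
    exacts [hBA h.1, h.1.1]
  · have hle : P⟦B ∩ S ∪ (A \ B) ∩ Sᶜ|m₁⟧ ≤ᵐ[P] fun ω => (P⟦A|m₁⟧) ω / 2 := by
      filter_upwards [hcond] with ω h1
      rw [h1]
      by_cases h2 : ω ∈ S
      · have : (P⟦B|m₁⟧) ω ≤ (P⟦A|m₁⟧) ω / 2 := h2
        simp [h2]
        exact this
      · have : ¬ (P⟦B|m₁⟧) ω ≤ (P⟦A|m₁⟧) ω / 2 := h2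
        simp [h2]
        linarith
    have h3 := integral_mono_ae integrable_condExp (integrable_condExp.div_const 2) hle
    rwa [integral_div, integral_condExp h₁, integral_condExp h₁,
      integral_indicator_const _ (h₂ _ hD), integral_indicator_const _ (h₂ _ hA),
      smul_eq_mul, smul_eq_mul, mul_one, mul_one] at h3
  · filter_upwards [hcond, hlt] with ω h1 h4 h5
    rw [h1]
    obtain ⟨h6, h7⟩ := h4 h5
    by_cases h2 : ω ∈ S
    · simpa [h2] using h6
    · simpa [h2] using h7

/-- Conditionally nonvanishing subsets whose indicators tend to zero. -/
lemma CondAtomless.exists_seq (h : CondAtomless P m₁ m₂) (h₁₂ : m₁ ≤ m₂) (h₂ : m₂ ≤ m₀)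
    {A : Set Ω} (hA : MeasurableSet[m₂] A) :
    ∃ D : ℕ → Set Ω, (∀ n, D n ⊆ A) ∧ (∀ n, MeasurableSet[m₂] (D n)) ∧
      (∀ n, ∀ᵐ ω ∂P, 0 < (P⟦A|m₁⟧) ω → 0 < (P⟦D n|m₁⟧) ω) ∧
      ∀ᵐ ω ∂P, Tendsto (fun n => ind (D n) ω) atTop (𝓝 0) := by
  choose! F hFA hF hFhalf hFpos using
    fun (A : Set Ω) (hA : MeasurableSet[m₂] A) => h.exists_half h₁₂ h₂ hA
  let D : ℕ → Set Ω := fun n => F^[n] A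
  have hsucc : ∀ n, D (n + 1) = F (D n) := fun n => Function.iterate_succ_apply' F n A
  have hD : ∀ n, MeasurableSet[m₂] (D n) := fun n => by
    induction n with
    | zero => exact hA
    | succ n ih => rw [hsucc]; exact hF _ ih
  have hanti : Antitone D := antitone_nat_of_succ_le fun n => by
    rw [hsucc]; exact hFA _ (hD n)
  refine ⟨D, fun n => hanti (Nat.zero_le n), hD, fun n => ?_, ?_⟩
  · induction n with
    | zero => exact ae_of_all _ fun ω h => h
    | succ n ih =>
      have h1 := hFpos _ (hD n)
      rw [hsucc]
      filter_upwards [ih, h1] with ω h2 h3 h4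
      exact h3 (h2 h4)
  · have hbound : ∀ n, P.real (D n) ≤ (1 / 2 : ℝ) ^ n := fun n => by
      induction n with
      | zero => simp
      | succ n ih =>
        have := hFhalf _ (hD n)
        rw [hsucc, pow_succ]
        linarith
    have hzero : P.real (⋂ n, D n) = 0 := by
      refine le_antisymm ?_ measureReal_nonneg
      refine ge_of_tendsto' (tendsto_pow_atTop_nhds_zero_of_lt_one (by norm_num)
        (by norm_num : (1 / 2 : ℝ) < 1)) fun n => ?_
      exact (measureReal_mono (Set.iInter_subset _ n)).trans (hbound n)
    have hnull : ∀ᵐ ω ∂P, ω ∉ ⋂ n, D n := by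
      exact measure_eq_zero_iff_ae_notMem.1 ((measureReal_eq_zero_iff).1 hzero)
    filter_upwards [hnull] with ω hω
    obtain ⟨N, hN⟩ : ∃ N, ω ∉ D N := by simpa using hω
    refine tendsto_const_nhds.congr' ?_
    filter_upwards [eventually_ge_atTop N] with n hn
    exact (Set.indicator_of_notMem (fun hmem => hN (hanti hn hmem)) _).symm

end Sets

/-- A nonempty family of sets which is stable under increasing countable unions has an element of
maximal measure. -/
lemma exists_maximal_measure {Ω : Type*} {m₀ : MeasurableSpace Ω} {P : Measure Ω}
    [IsFiniteMeasure P] (C : Set Ω → Prop) (h0 : C ∅)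
    (hU : ∀ s : ℕ → Set Ω, Monotone s → (∀ n, C (s n)) → C (⋃ n, s n)) :
    ∃ E, C E ∧ ∀ E', C E' → E ⊆ E' → P.real E' ≤ P.real E := by
  -- Greedy choice: B realizes at least half of the measure that can still be gained over A.
  have hstep : ∀ A : Set Ω, C A → ∃ B, C B ∧ A ⊆ B ∧
      ∀ E', C E' → A ⊆ E' → P.real E' ≤ 2 * P.real B - P.real A := by
    intro A hA
    set s : Set ℝ := {x | ∃ E', C E' ∧ A ⊆ E' ∧ P.real E' = x} with hs
    have hbdd : BddAbove s := ⟨P.real Set.univ, by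
      rintro x ⟨E', -, -, rfl⟩
      exact measureReal_mono (Set.subset_univ _)⟩
    have hmem : P.real A ∈ s := ⟨A, hA, subset_rfl, rfl⟩
    rcases (le_csSup hbdd hmem).eq_or_lt with heq | hlt
    · refine ⟨A, hA, subset_rfl, fun E' hE' hAE' => ?_⟩
      have := le_csSup hbdd (show P.real E' ∈ s from ⟨E', hE', hAE', rfl⟩)
      linarith
    · obtain ⟨x, ⟨B, hB, hAB, rfl⟩, hx⟩ := exists_lt_of_lt_csSup ⟨_, hmem⟩
        (show (P.real A + sSup s) / 2 < sSup s by linarith)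
      refine ⟨B, hB, hAB, fun E' hE' hAE' => ?_⟩
      have := le_csSup hbdd (show P.real E' ∈ s from ⟨E', hE', hAE', rfl⟩)
      linarith
  choose! F hFC hFsub hFmax using hstep
  let D : ℕ → Set Ω := fun n => F^[n] ∅
  have hsucc : ∀ n, D (n + 1) = F (D n) := fun n => Function.iterate_succ_apply' F n ∅
  have hD : ∀ n, C (D n) := fun n => by
    induction n with
    | zero => exact h0
    | succ n ih => rw [hsucc]; exact hFC _ ih
  have hmono : Monotone D := monotone_nat_of_le_succ fun n => by
    rw [hsucc]; exact hFsub _ (hD n)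
  refine ⟨⋃ n, D n, hU D hmono hD, fun E' hE' hsub => ?_⟩
  have hlim : Tendsto (fun n => P.real (D n)) atTop (𝓝 (P.real (⋃ n, D n))) :=
    (ENNReal.tendsto_toReal (measure_ne_top P _)).comp (tendsto_measure_iUnion_atTop hmono)
  -- The gains tend to 0, so the bound 2 P(D (n+1)) - P(D n) tends to the measure of the union.
  have hlim2 := ((hlim.comp (tendsto_add_atTop_nat 1)).const_mul 2).sub hlim
  have hge : P.real E' ≤ 2 * P.real (⋃ n, D n) - P.real (⋃ n, D n) :=
    ge_of_tendsto' hlim2 fun n => by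
      simp only [Function.comp]
      rw [hsucc]
      exact hFmax _ (hD n) E' hE' ((Set.subset_iUnion D n).trans hsub)
  linarith

/-! ### Sets of conditional utility 1/2 and additivity on F_t -/

section Half

variable {Ω : Type*} {m₀ : MeasurableSpace Ω} {P : Measure Ω} [IsProbabilityMeasure P]
  {m₁ m₂ : MeasurableSpace Ω}
  {v : (Ω → ℝ) → Ω → ℝ} {φ : (Ω → ℝ) → ℝ}

/-- There is a set whose indicator has conditional utility `1 / 2`. -/
lemma exists_cond_eq_half (hv : IsConditionalUtility P m₁ m₂ v) (h₁₂ : m₁ ≤ m₂) (h₂ : m₂ ≤ m₀)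
    (hφ : IsUtilityFunctional P m₂ φ) (hcons : ∀ f, BddMeas m₂ f → φ f = φ (v f))
    (hat : CondAtomless P m₁ m₂) :
    ∃ E, MeasurableSet[m₂] E ∧ ∀ᵐ ω ∂P, v (ind E) ω = 1 / 2 := by
  have hbdd : ∀ s : ℕ → Set Ω, ∃ C : ℝ, ∀ n ω, |ind (s n) ω| ≤ C := fun s =>
    ⟨1, fun n ω => by by_cases h : ω ∈ s n <;> simp [h]⟩
  obtain ⟨E, ⟨hE, hEle⟩, hmax⟩ := exists_maximal_measure (P := P)
    (fun E => MeasurableSet[m₂] E ∧ ∀ᵐ ω ∂P, v (ind E) ω ≤ 1 / 2)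
    ⟨@MeasurableSet.empty _ m₂, by
      filter_upwards [hv.map_const 0] with ω hω
      simp only [ind, Set.indicator_empty, hω]
      norm_num⟩
    (fun s hs hC => ⟨MeasurableSet.iUnion fun n => (hC n).1,
      cond_le_of_tendsto hv h₁₂ hφ hcons (fun n => BddMeas.ind (hC n).1)
        (BddMeas.ind (MeasurableSet.iUnion fun n => (hC n).1)) (hbdd s)
        (ae_of_all _ fun ω => (hs.tendsto_indicator s _ ω).mono_right (pure_le_nhds _))
        (BddMeas.const (1 / 2)) fun n => (hC n).2⟩)
  refine ⟨E, hE, ?_⟩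
  have h₁ : m₁ ≤ m₀ := h₁₂.trans h₂
  obtain ⟨D, hDE, hD, hDpos, hDlim⟩ := hat.exists_seq h₁₂ h₂ hE.compl
  have hnD := fun n => (BddMeas.ind (hD n)).neg
  have hvE := hv.bddMeas (BddMeas.ind hE)
  have hvD := fun n => hv.bddMeas (hnD n)
  -- The deficit 1/2 - v(1_E) is at most -v(-1_{D n}), which disappears in the limit.
  have key : ∀ n, v (fun ω => -ind (D n) ω) ≤ᵐ[P] fun ω => v (ind E) ω - 1 / 2 := by
    intro n
    -- Where the constraint is slack and enlarging E by D n is harmless: superadditivity gives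
    -- v(1_{E ∪ D n}) ≤ v(1_E) - v(-1_{D n}). By locality E ∪ (D n ∩ S) is still admissible.
    set S := {ω | v (ind E) ω < 1 / 2} ∩
      {ω | v (ind E) ω - v (fun ω => -ind (D n) ω) ω ≤ 1 / 2}
    have hS : MeasurableSet[m₁] S :=
      (hvE.measurableSet_lt (BddMeas.const _)).inter
        ((hvE.sub (hvD n)).measurableSet_le (BddMeas.const _))
    have hDS : MeasurableSet[m₂] (D n ∩ S) := (hD n).inter (h₁₂ _ hS)
    have hE' : MeasurableSet[m₂] (E ∪ D n ∩ S) := hE.union hDS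
    have hon : ∀ᵐ ω ∂P, ω ∈ S → v (ind (E ∪ D n ∩ S)) ω = v (ind (E ∪ D n)) ω :=
      hv.local_eq h₁₂ (BddMeas.ind hE') (BddMeas.ind (hE.union (hD n))) hS
        (ae_of_all _ fun ω hω => by
          by_cases h1 : ω ∈ E <;> by_cases h2 : ω ∈ D n <;> simp [h1, h2, hω])
    have hoff : ∀ᵐ ω ∂P, ω ∈ Sᶜ → v (ind (E ∪ D n ∩ S)) ω = v (ind E) ω :=
      hv.local_eq h₁₂ (BddMeas.ind hE') (BddMeas.ind hE) hS.compl
        (ae_of_all _ fun ω hω => by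
          have : ω ∉ S := hω
          by_cases h1 : ω ∈ E <;> simp [h1, this])
    have hsum := hv.superadd (BddMeas.ind (hE.union (hD n))) (hnD n)
    have hEeq : v (fun ω => ind (E ∪ D n) ω + -ind (D n) ω) =ᵐ[P] v (ind E) := by
      refine hv.congr ((BddMeas.ind (hE.union (hD n))).add (hnD n)) (BddMeas.ind hE)
        (ae_of_all _ fun ω => ?_)
      by_cases h1 : ω ∈ D n
      · have : ω ∉ E := hDE n h1
        simp [h1, this]
      · by_cases h2 : ω ∈ E <;> simp [h1, h2]
    have hle' : ∀ᵐ ω ∂P, v (ind (E ∪ D n ∩ S)) ω ≤ 1 / 2 := by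
      filter_upwards [hon, hoff, hsum, hEeq, hEle] with ω h1 h2 h3 h4 h5
      by_cases hω : ω ∈ S
      · have := hω.2
        simp only [Set.mem_ofPred_eq] at this
        rw [h1 hω]
        linarith
      · rw [h2 hω]
        exact h5
    have hmeas := hmax _ ⟨hE', hle'⟩ Set.subset_union_left
    have hdisj : Disjoint E (D n ∩ S) :=
      Set.disjoint_left.2 fun ω h1 h2 => hDE n h2.1 h1
    rw [measureReal_union hdisj (h₂ _ hDS)] at hmeas
    have hDS0 : P.real (D n ∩ S) = 0 := le_antisymm (by linarith) measureReal_nonneg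
    have hint : ∫ ω in S, (P⟦D n|m₁⟧) ω ∂P = 0 := by
      rw [setIntegral_condExp h₁ ((BddMeas.ind (hD n)).integrable h₂) hS,
        setIntegral_indicator (h₂ _ (hD n)), setIntegral_const, smul_eq_mul, mul_one,
        Set.inter_comm, hDS0]
    have hDnn : 0 ≤ᵐ[P] P⟦D n|m₁⟧ :=
      condExp_nonneg (ae_of_all _ fun ω => Set.indicator_nonneg (fun _ _ => zero_le_one) ω)
    have hcD : ∀ᵐ ω ∂P, ω ∈ S → (P⟦D n|m₁⟧) ω = 0 := by
      have := (setIntegral_eq_zero_iff_of_nonneg_ae (ae_restrict_of_ae hDnn)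
        integrable_condExp.integrableOn).1 hint
      exact (ae_restrict_iff' (h₁ _ hS)).1 this
    -- D n is conditionally nonnull wherever Eᶜ is. So E fills S up to a null set, which forces
    -- v(1_E) = 1 there and contradicts v(1_E) < 1/2.
    have hcE : ∀ᵐ ω ∂P, ω ∈ S → (P⟦Eᶜ|m₁⟧) ω = 0 := by
      have hnn : 0 ≤ᵐ[P] P⟦Eᶜ|m₁⟧ :=
        condExp_nonneg (ae_of_all _ fun ω => Set.indicator_nonneg (fun _ _ => zero_le_one) ω)
      filter_upwards [hcD, hDpos n, hnn] with ω h1 h2 h3 h4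
      by_contra hne
      exact (h2 (lt_of_le_of_ne h3 (Ne.symm hne))).ne' (h1 h4)
    have hES : P.real (Eᶜ ∩ S) = 0 := by
      have h5 : ∫ ω in S, (P⟦Eᶜ|m₁⟧) ω ∂P = 0 := by
        rw [setIntegral_congr_ae (h₁ _ hS) hcE]
        simp
      rwa [setIntegral_condExp h₁ ((BddMeas.ind hE.compl).integrable h₂) hS,
        setIntegral_indicator (h₂ _ hE.compl), setIntegral_const, smul_eq_mul, mul_one,
        Set.inter_comm] at h5
    have hES' : ∀ᵐ ω ∂P, ω ∉ Eᶜ ∩ S := by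
      exact measure_eq_zero_iff_ae_notMem.1 ((measureReal_eq_zero_iff).1 hES)
    have hone : ∀ᵐ ω ∂P, ω ∈ S → v (ind E) ω = v (fun _ => 1) ω :=
      hv.local_eq h₁₂ (BddMeas.ind hE) (BddMeas.const 1) hS (by
        filter_upwards [hES'] with ω h1 h2
        have : ω ∈ E := by
          by_contra h3
          exact h1 ⟨h3, h2⟩
        simp [this])
    have hneg : v (fun ω => -ind (D n) ω) ≤ᵐ[P] v (fun _ => 0) :=
      hv.mono (hnD n) (BddMeas.const 0) (ae_of_all _ fun ω =>
        neg_nonpos.2 (Set.indicator_nonneg (fun _ _ => zero_le_one) ω))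
    filter_upwards [hone, hneg, hv.map_const 0, hv.map_const 1, hEle] with ω h1 h2 h3 h4 h5
    rw [h3] at h2
    by_cases hω : ω ∈ S
    · have h6 : v (ind E) ω < 1 / 2 := hω.1
      rw [h1 hω, h4] at h6
      norm_num at h6
    · rcases h5.eq_or_lt with h6 | h6
      · linarith
      · have : ¬ (v (ind E) ω - v (fun ω => -ind (D n) ω) ω ≤ 1 / 2) := fun h7 => hω ⟨h6, h7⟩
        linarith
  have hfin := cond_le_of_tendsto hv h₁₂ hφ hcons hnD (BddMeas.const 0)
    (by simpa only [abs_neg] using hbdd D)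
    (by filter_upwards [hDlim] with ω hω; simpa using hω.neg)
    (hvE.sub (BddMeas.const (1 / 2))) key
  filter_upwards [hfin, hEle, hv.map_const 0] with ω h1 h2 h3
  rw [h3] at h1
  linarith

/-- A consistent functional is additive on `m₁`. -/
lemma map_ind_add_map_ind_compl (hv : IsConditionalUtility P m₁ m₂ v) (h₁₂ : m₁ ≤ m₂)
    (h₂ : m₂ ≤ m₀) (hφ : IsUtilityFunctional P m₂ φ)
    (hcons : ∀ f, BddMeas m₂ f → φ f = φ (v f)) (hat : CondAtomless P m₁ m₂)
    {A : Set Ω} (hA : MeasurableSet[m₁] A) : φ (ind A) + φ (ind Aᶜ) = 1 := by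
  obtain ⟨E, hE, hhalf⟩ := exists_cond_eq_half hv h₁₂ h₂ hφ hcons hat
  have hA₂ := h₁₂ _ hA
  have hmA := BddMeas.ind hA₂
  have hmE := BddMeas.ind hE
  have hmAc := BddMeas.ind hA₂.compl
  have hA0 : ∀ ω, 0 ≤ ind A ω := fun ω => Set.indicator_nonneg (fun _ _ => zero_le_one) ω
  -- the value of `φ` at `c 1_A 1_E + d 1_{Aᶜ}`
  have hval : ∀ c : ℝ, 0 ≤ c → ∀ d : ℝ,
      φ (fun ω => c * ind A ω * ind E ω + d * ind Aᶜ ω) =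
        φ (fun ω => c / 2 * ind A ω + d * ind Aᶜ ω) := by
    intro c hc d
    have hcA : BddMeas m₁ fun ω => c * ind A ω := (BddMeas.const c).mul (BddMeas.ind hA)
    have hdA : BddMeas m₁ fun ω => d * ind Aᶜ ω := (BddMeas.const d).mul (BddMeas.ind hA.compl)
    have hbm := ((hcA.mono h₁₂).mul hmE).add (hdA.mono h₁₂)
    rw [hcons _ hbm]
    refine hφ.congr ((hv.bddMeas hbm).mono h₁₂)
      ((((BddMeas.const (c / 2)).mul hmA).add (hdA.mono h₁₂))) ?_
    filter_upwards [hv.translation ((hcA.mono h₁₂).mul hmE) hdA,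
      hv.homog hcA hmE fun ω => mul_nonneg hc (hA0 ω), hhalf] with ω h1 h2 h3
    rw [h1, h2, h3]
    ring
  -- The pairs (c, d) = (1, 0), (1, 1), (2, 1) describe 1_{E ∩ A}, 1_{E ∪ Aᶜ} and their sum.
  have e1 : φ (ind (E ∩ A)) = 1 / 2 * φ (ind A) := by
    rw [← hφ.homog (by norm_num) hmA]
    convert hval 1 zero_le_one 0 using 2 <;> ext ω
    · by_cases h1 : ω ∈ A <;> by_cases h2 : ω ∈ E <;> simp [h1, h2]
    · ring
  have e2 : φ (ind (E ∪ Aᶜ)) = 1 / 2 * φ (ind Aᶜ) + 1 / 2 := by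
    rw [← hφ.homog (by norm_num) hmAc,
      ← hφ.translation _ ((BddMeas.const (1 / 2)).mul hmAc)]
    convert hval 1 zero_le_one 1 using 2 <;> ext ω
    · by_cases h1 : ω ∈ A <;> by_cases h2 : ω ∈ E <;> simp [h1, h2]
    · by_cases h1 : ω ∈ A <;> norm_num [h1]
  have e3 : φ (fun ω => ind (E ∩ A) ω + ind (E ∪ Aᶜ) ω) = 1 := by
    rw [← hφ.map_const 1]
    convert hval 2 zero_le_two 1 using 2 <;> ext ω
    · by_cases h1 : ω ∈ A <;> by_cases h2 : ω ∈ E <;> norm_num [h1, h2]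
    · by_cases h1 : ω ∈ A <;> norm_num [h1]
  have hcom := hφ.commonotone (hE.inter hA₂) (hE.union hA₂.compl)
    (Set.inter_subset_left.trans Set.subset_union_left)
  linarith

end Half

/-! ### Representation of additive functionals by measures -/

namespace IsUtilityFunctional

variable {Ω : Type*} {m₀ : MeasurableSpace Ω} {P : Measure Ω} {m : MeasurableSpace Ω}
  {φ : (Ω → ℝ) → ℝ} {f g : Ω → ℝ}

/-- Superadditivity closes a circle: φ(f) + φ(g) ≤ φ(f+g) ≤ -φ(-(f+g)) ≤ -φ(-f) - φ(-g) = φ(f) +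
φ(g). -/
lemma map_add_of_symm (hφ : IsUtilityFunctional P m φ) (hf : BddMeas m f) (hg : BddMeas m g)
    (hf0 : φ f + φ (fun ω => -f ω) = 0) (hg0 : φ g + φ (fun ω => -g ω) = 0) :
    φ (fun ω => f ω + g ω) = φ f + φ g ∧
      φ (fun ω => f ω + g ω) + φ (fun ω => -(f ω + g ω)) = 0 := by
  have h1 := hφ.superadd hf hg
  have h2 := hφ.superadd hf.neg hg.neg
  have h3 := hφ.superadd (hf.add hg) (hf.add hg).neg
  simp only [add_neg_cancel, hφ.map_const] at h3
  simp only [← neg_add] at h2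
  constructor <;> linarith

lemma map_const_mul_of_symm (hφ : IsUtilityFunctional P m φ) (hf : BddMeas m f)
    (hf0 : φ f + φ (fun ω => -f ω) = 0) (c : ℝ) :
    φ (fun ω => c * f ω) = c * φ f ∧
      φ (fun ω => c * f ω) + φ (fun ω => -(c * f ω)) = 0 := by
  rcases le_total 0 c with hc | hc
  · have h1 := hφ.homog hc hf
    have h2 := hφ.homog hc hf.neg
    simp only [mul_neg] at h2
    refine ⟨h1, ?_⟩
    rw [h1, h2, ← mul_add, hf0, mul_zero]
  · have h1 := hφ.homog (neg_nonneg.2 hc) hf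
    have h2 := hφ.homog (neg_nonneg.2 hc) hf.neg
    simp only [neg_mul, mul_neg, neg_neg] at h1 h2
    refine ⟨by linear_combination h2 - c * hf0, ?_⟩
    linear_combination h1 + h2 - c * hf0

lemma map_sum_of_symm (hφ : IsUtilityFunctional P m φ) {F : ℕ → Ω → ℝ}
    (hF : ∀ n, BddMeas m (F n)) (hF0 : ∀ n, φ (F n) + φ (fun ω => -F n ω) = 0) (n : ℕ) :
    BddMeas m (fun ω => ∑ i ∈ Finset.range n, F i ω) ∧
    φ (fun ω => ∑ i ∈ Finset.range n, F i ω) = ∑ i ∈ Finset.range n, φ (F i) ∧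
      φ (fun ω => ∑ i ∈ Finset.range n, F i ω) +
        φ (fun ω => -∑ i ∈ Finset.range n, F i ω) = 0 := by
  induction n with
  | zero => simpa [hφ.map_const] using BddMeas.const 0
  | succ n ih =>
    obtain ⟨h1, h2, h3⟩ := ih
    have h4 := hφ.map_add_of_symm h1 (hF n) h3 (hF0 n)
    simp only [Finset.sum_range_succ, ← h2]
    exact ⟨h1.add (hF n), h4⟩

/-- By disjointness the partial sums of indicators stay in [0, 1], so Lebesgue continuity applies to
them and to their negatives. -/
lemma map_iUnion_of_symm (hφ : IsUtilityFunctional P m φ) {A : ℕ → Set Ω}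
    (hA : ∀ n, MeasurableSet[m] (A n)) (hd : Pairwise (Function.onFun Disjoint A))
    (h0 : ∀ n, φ (ind (A n)) + φ (fun ω => -ind (A n) ω) = 0) :
    φ (ind (⋃ n, A n)) + φ (fun ω => -ind (⋃ n, A n) ω) = 0 ∧
      Tendsto (fun n => ∑ i ∈ Finset.range n, φ (ind (A i))) atTop (𝓝 (φ (ind (⋃ n, A n)))) := by
  have hS := hφ.map_sum_of_symm (fun n => BddMeas.ind (hA n)) h0
  have hU : BddMeas m (ind (⋃ n, A n)) := BddMeas.ind (MeasurableSet.iUnion hA)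
  have hval : ∀ {ω j}, ω ∈ A j → ∀ i, ind (A i) ω = if i = j then 1 else 0 := by
    intro ω j hj i
    by_cases hij : i = j
    · subst hij
      simp [hj]
    · have : ω ∉ A i := fun hi => Set.disjoint_left.1 (hd hij) hi hj
      simp [this, hij]
  have hb : ∃ C : ℝ, ∀ n ω, |∑ i ∈ Finset.range n, ind (A i) ω| ≤ C := by
    refine ⟨1, fun n ω => ?_⟩
    by_cases h : ∃ j, ω ∈ A j
    · obtain ⟨j, hj⟩ := h
      simp only [hval hj, Finset.sum_ite_eq']
      split_ifs <;> simp
    · push Not at h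
      simp [h]
  have hlim : ∀ᵐ ω ∂P, Tendsto (fun n => ∑ i ∈ Finset.range n, ind (A i) ω) atTop
      (𝓝 (ind (⋃ n, A n) ω)) := by
    refine ae_of_all _ fun ω => ?_
    by_cases h : ∃ j, ω ∈ A j
    · obtain ⟨j, hj⟩ := h
      have hmem : ω ∈ ⋃ n, A n := Set.mem_iUnion.2 ⟨j, hj⟩
      simp only [hval hj, Finset.sum_ite_eq', Set.indicator_of_mem hmem]
      refine tendsto_const_nhds.congr' ?_
      filter_upwards [eventually_gt_atTop j] with n hn
      simp [hn]
    · push Not at h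
      simp [h]
  have h1 := hφ.lebesgue (fun n => (hS n).1) hU hb hlim
  have h2 := hφ.lebesgue (fun n => (hS n).1.neg) hU.neg (by simpa only [abs_neg] using hb)
    (hlim.mono fun ω h => h.neg)
  refine ⟨tendsto_nhds_unique (h1.add h2) ?_, ?_⟩
  · simp only [(hS _).2.2]
    exact tendsto_const_nhds
  · simpa only [(hS _).2.1] using h1

/-- Symmetry on a generating π-system extends to the generated σ-algebra. -/
lemma symm_of_generateFrom (hφ : IsUtilityFunctional P m φ) {s : Set (Set Ω)}
    (hs : m = MeasurableSpace.generateFrom s) (hpi : IsPiSystem s)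
    (h : ∀ A ∈ s, φ (ind A) + φ (fun ω => -ind A ω) = 0) {A : Set Ω} (hA : MeasurableSet[m] A) :
    φ (ind A) + φ (fun ω => -ind A ω) = 0 := by
  induction A, hA using MeasurableSpace.induction_on_inter hs hpi with
  | empty => simp [ind, hφ.map_const]
  | basic t ht => exact h t ht
  | compl t ht ih =>
    -- 1_{tᶜ} = 1 - 1_t is a sum of two symmetric functions.
    have h1 := hφ.map_add_of_symm (BddMeas.const 1) (BddMeas.ind ht).neg
      (by simp only [hφ.map_const]; norm_num) (by simpa only [neg_neg, add_comm] using ih)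
    have h2 : ind tᶜ = fun ω => 1 + -ind t ω := by
      ext ω
      by_cases hω : ω ∈ t <;> simp [hω]
    rw [h2]
    exact h1.2
  | iUnion F hd hF ih => exact (hφ.map_iUnion_of_symm hF hd ih).1

variable [IsProbabilityMeasure P]

/-- A ↦ φ(1_A) is a measure on `m` only, so Radon–Nikodym is applied against the restriction of P to
`m`. The density then defines a measure on all of `m₀`. -/
lemma exists_density (hφ : IsUtilityFunctional P m φ) (hm : m ≤ m₀)
    (hsymm : ∀ A, MeasurableSet[m] A → φ (ind A) + φ (fun ω => -ind A ω) = 0) :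
    ∃ g : Ω → ℝ≥0∞, Measurable[m] g ∧
      ∀ A, MeasurableSet[m] A → ∫⁻ ω in A, g ω ∂P = ENNReal.ofReal (φ (ind A)) := by
  have hnn : ∀ A, MeasurableSet[m] A → 0 ≤ φ (ind A) := fun A hA => by
    rw [← hφ.map_const 0]
    exact hφ.mono (BddMeas.const 0) (BddMeas.ind hA)
      (ae_of_all _ fun ω => Set.indicator_nonneg (fun _ _ => zero_le_one) ω)
  let ν : @Measure Ω m := @Measure.ofMeasurable Ω m (fun A _ => ENNReal.ofReal (φ (ind A)))
    (by simp [ind, hφ.map_const]) (fun F hF hd => by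
      have h := (hφ.map_iUnion_of_symm hF hd fun n => hsymm _ (hF n)).2
      have hs := (hasSum_iff_tendsto_nat_of_nonneg (fun n => hnn _ (hF n)) _).2 h
      rw [← ENNReal.ofReal_tsum_of_nonneg (fun n => hnn _ (hF n)) hs.summable, hs.tsum_eq])
  have hν : ∀ A, MeasurableSet[m] A → ν A = ENNReal.ofReal (φ (ind A)) := fun A hA =>
    @Measure.ofMeasurable_apply Ω m _ _ _ A hA
  have hfin : @IsFiniteMeasure Ω m ν := ⟨by
    rw [hν _ (@MeasurableSet.univ _ m)]
    exact ENNReal.ofReal_lt_top⟩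
  have hac : ν ≪ P.trim hm := by
    refine @Measure.AbsolutelyContinuous.mk Ω m _ _ fun A hA h0 => ?_
    rw [trim_measurableSet_eq hm hA] at h0
    rw [hν _ hA, hφ.congr (BddMeas.ind hA) (BddMeas.const 0), hφ.map_const, ENNReal.ofReal_zero]
    filter_upwards [measure_eq_zero_iff_ae_notMem.1 h0] with ω hω
    simp [hω]
  have hg : Measurable[m] (ν.rnDeriv (P.trim hm)) := Measure.measurable_rnDeriv _ _
  refine ⟨ν.rnDeriv (P.trim hm), hg, fun A hA => ?_⟩
  rw [← lintegral_indicator (hm _ hA), ← lintegral_trim hm (hg.indicator hA),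
    lintegral_indicator hA, ← withDensity_apply _ hA, Measure.withDensity_rnDeriv_eq _ _ hac,
    hν _ hA]

/-- A functional which is symmetric on indicators is the expectation for an equivalent
probability measure. -/
theorem exists_measure (hφ : IsUtilityFunctional P m φ) (hm : m ≤ m₀)
    (hsymm : ∀ A, MeasurableSet[m] A → φ (ind A) + φ (fun ω => -ind A ω) = 0) :
    ∃ Q : @Measure Ω m₀, IsProbabilityMeasure Q ∧ Q ≪ P ∧ P ≪ Q ∧
      ∀ f, BddMeas m f → φ f = ∫ ω, f ω ∂Q := by
  obtain ⟨g, hg, hgint⟩ := hφ.exists_density hm hsymm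
  have hQ : ∀ A, MeasurableSet[m] A → P.withDensity g A = ENNReal.ofReal (φ (ind A)) :=
    fun A hA => by rw [withDensity_apply _ (hm _ hA), hgint A hA]
  have hprob : IsProbabilityMeasure (P.withDensity g) := ⟨by
    rw [hQ _ (@MeasurableSet.univ _ m)]
    simp [ind, hφ.map_const]⟩
  refine ⟨P.withDensity g, hprob, withDensity_absolutelyContinuous _ _, ?_, ?_⟩
  -- On Z = {g = 0} the density gives φ(1_Z) = 0, hence φ(-1_Z) = 0 by symmetry, which relevance
  -- forbids unless Z is null.
  · have hZ : MeasurableSet[m] {ω | g ω = 0} := hg (measurableSet_singleton 0)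
    have hne : P {ω | g ω = 0} = 0 := by
      by_contra hpos
      have h1 := hφ.relevant hZ (pos_iff_ne_zero.2 hpos)
      have h2 : ENNReal.ofReal (φ (ind {ω | g ω = 0})) = 0 := by
        rw [← hgint _ hZ, setLIntegral_congr_fun (hm _ hZ) (fun ω (hω : g ω = 0) => hω)]
        simp
      have h3 := ENNReal.ofReal_eq_zero.1 h2
      have h4 := hsymm _ hZ
      linarith
    refine withDensity_absolutelyContinuous' (hg.mono hm le_rfl).aemeasurable ?_
    exact measure_eq_zero_iff_ae_notMem.1 hne
  -- Symmetry is carried through the induction because additivity of φ needs it.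
  · have hsimple : ∀ F : @SimpleFunc Ω m ℝ, BddMeas m F ∧ φ F + φ (fun ω => -F ω) = 0 ∧
        φ F = ∫ ω, F ω ∂(P.withDensity g) := by
      intro F
      induction F using SimpleFunc.induction with
      | @const c s hs =>
        have heq : ⇑(SimpleFunc.piecewise s hs (SimpleFunc.const Ω c) (SimpleFunc.const Ω 0)) =
            fun ω => c * ind s ω := by
          ext ω
          by_cases hω : ω ∈ s <;> simp [hω]
        have h1 := hφ.map_const_mul_of_symm (BddMeas.ind hs) (hsymm s hs) c
        have hnn : 0 ≤ φ (ind s) := by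
          rw [← hφ.map_const 0]
          exact hφ.mono (BddMeas.const 0) (BddMeas.ind hs)
            (ae_of_all _ fun ω => Set.indicator_nonneg (fun _ _ => zero_le_one) ω)
        rw [heq]
        refine ⟨(BddMeas.const c).mul (BddMeas.ind hs), h1.2, ?_⟩
        rw [h1.1, integral_const_mul, integral_indicator_const _ (hm _ hs), measureReal_def, hQ s hs,
          ENNReal.toReal_ofReal hnn, smul_eq_mul, mul_one]
      | @add F G hFG hF hG =>
        have h1 := hφ.map_add_of_symm hF.1 hG.1 hF.2.1 hG.2.1
        refine ⟨hF.1.add hG.1, h1.2, h1.1.trans ?_⟩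
        rw [hF.2.2, hG.2.2]
        exact (integral_add (hF.1.integrable hm) (hG.1.integrable hm)).symm
    intro f hf
    obtain ⟨C, hC⟩ := hf.2
    have hsm : StronglyMeasurable[m] f := hf.1.stronglyMeasurable
    have hC0 : 0 ≤ max C 0 := le_max_right _ _
    have hbd : ∀ n ω, |hsm.approxBounded (max C 0) n ω| ≤ max C 0 := fun n ω =>
      hsm.norm_approxBounded_le hC0 n ω
    have hlim : ∀ ω, Tendsto (fun n => hsm.approxBounded (max C 0) n ω) atTop (𝓝 (f ω)) :=
      fun ω => hsm.tendsto_approxBounded_of_norm_le ((hC ω).trans (le_max_left _ _))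
    have h1 := hφ.lebesgue (fun n => (hsimple (hsm.approxBounded (max C 0) n)).1) hf
      ⟨_, hbd⟩ (ae_of_all _ hlim)
    have h2 := tendsto_integral_of_dominated_convergence (μ := P.withDensity g)
      (fun _ => max C 0)
      (fun n => ((hsimple (hsm.approxBounded (max C 0) n)).1.integrable hm).aestronglyMeasurable)
      (integrable_const _) (fun n => ae_of_all _ (hbd n)) (ae_of_all _ hlim)
    simp only [(hsimple _).2.2] at h1
    exact tendsto_nhds_unique h1 h2

end IsUtilityFunctional

/-! ### From classes in `L^∞` to bounded measurable functions -/

namespace LInfty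

section

variable {Ω : Type*} {m₀ : MeasurableSpace Ω} {P : Measure Ω} {m : MeasurableSpace Ω}

lemma ext {ξ η : LInfty P m} (h : (ξ : Lp ℝ ∞ P) =ᵐ[P] (η : Lp ℝ ∞ P)) : ξ = η :=
  Subtype.ext (Lp.ext h)

lemma exists_bddMeas (ξ : LInfty P m) : ∃ f, BddMeas m f ∧ (ξ : Lp ℝ ∞ P) =ᵐ[P] f := by
  have hmeas : AEStronglyMeasurable[m] ((ξ : Lp ℝ ∞ P) : Ω → ℝ) P :=
    mem_lpMeas_iff_aestronglyMeasurable.1 ξ.2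
  obtain ⟨g, hg, hξg⟩ := hmeas
  have hbound := ae_le_lpNorm_exponent_top (Lp.memLp (ξ : Lp ℝ ∞ P))
  have hC0 : 0 ≤ lpNorm (ξ : Lp ℝ ∞ P) ∞ P := lpNorm_nonneg
  set C := lpNorm (ξ : Lp ℝ ∞ P) ∞ P
  refine ⟨fun ω => max (-C) (min C (g ω)), ⟨?_, C, fun ω => ?_⟩, ?_⟩
  · exact Measurable.max (@measurable_const _ _ _ m _)
      (Measurable.min (@measurable_const _ _ _ m _) hg.measurable)
  · exact abs_le.2 ⟨le_max_left _ _, max_le (by linarith) (min_le_left _ _)⟩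
  · filter_upwards [hξg, hbound] with ω h1 h2
    rw [h1, Real.norm_eq_abs, abs_le] at h2
    rw [h1, min_eq_right h2.2, max_eq_right h2.1]

/-- A bounded measurable representative. -/
noncomputable def rep (ξ : LInfty P m) : Ω → ℝ := (exists_bddMeas ξ).choose

lemma rep_bddMeas (ξ : LInfty P m) : BddMeas m (rep ξ) := (exists_bddMeas ξ).choose_spec.1

lemma coe_ae_eq_rep (ξ : LInfty P m) : (ξ : Lp ℝ ∞ P) =ᵐ[P] rep ξ :=
  (exists_bddMeas ξ).choose_spec.2

open Classical in
/-- The class of a function, or `0` when there is none. -/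
noncomputable def ofFun (P : @Measure Ω m₀) (m : MeasurableSpace Ω) (f : Ω → ℝ) : LInfty P m :=
  if h : ∃ ξ : LInfty P m, (ξ : Lp ℝ ∞ P) =ᵐ[P] f then h.choose else 0

lemma ofFun_eq {ξ : LInfty P m} {f : Ω → ℝ} (h : (ξ : Lp ℝ ∞ P) =ᵐ[P] f) : ofFun P m f = ξ := by
  have hex : ∃ ξ : LInfty P m, (ξ : Lp ℝ ∞ P) =ᵐ[P] f := ⟨ξ, h⟩
  rw [ofFun, dif_pos hex]
  exact ext (hex.choose_spec.trans h.symm)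

lemma coe_ofFun [IsFiniteMeasure P] (hm : m ≤ m₀) {f : Ω → ℝ} (hf : BddMeas m f) :
    (ofFun P m f : Lp ℝ ∞ P) =ᵐ[P] f := by
  obtain ⟨C, hC⟩ := hf.2
  have hmem : MemLp f ∞ P :=
    MemLp.of_bound (hf.1.mono hm le_rfl).aestronglyMeasurable C (ae_of_all _ hC)
  have hlp : hmem.toLp f ∈ LInfty P m := by
    refine mem_lpMeas_iff_aestronglyMeasurable.2 ?_
    exact ⟨f, hf.1.stronglyMeasurable, hmem.coeFn_toLp⟩
  have h : ((⟨hmem.toLp f, hlp⟩ : LInfty P m) : Lp ℝ ∞ P) =ᵐ[P] f := hmem.coeFn_toLp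
  rw [ofFun_eq h]
  exact h

end

section

variable {Ω : Type*} {m₀ : MeasurableSpace Ω} {P : Measure Ω} {m₁ m₂ : MeasurableSpace Ω}
  {u : LInfty P m₂ → LInfty P m₁}

/-- The operator on functions induced by an operator on classes. -/
noncomputable def lift (u : LInfty P m₂ → LInfty P m₁) (f : Ω → ℝ) : Ω → ℝ :=
  rep (u (ofFun P m₂ f))

lemma lift_bddMeas (u : LInfty P m₂ → LInfty P m₁) (f : Ω → ℝ) : BddMeas m₁ (lift u f) :=
  rep_bddMeas _

lemma coe_ae_eq_lift (u : LInfty P m₂ → LInfty P m₁) (f : Ω → ℝ) :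
    (u (ofFun P m₂ f) : Lp ℝ ∞ P) =ᵐ[P] lift u f := coe_ae_eq_rep _

end

end LInfty

/-! ### Transfer of the axioms from classes to functions -/

section Transfer

variable {Ω : Type*} {m₀ : MeasurableSpace Ω} {P : Measure Ω} [IsProbabilityMeasure P]
  {m₁ m₂ : MeasurableSpace Ω} {u : LInfty P m₂ → LInfty P m₁}

open LInfty

/-- Superadditivity is concavity at weight 1/2 combined with homogeneity. Monotonicity follows from
v(f) + v(g - f) ≤ v(g) and v(g - f) ≥ 0. -/
lemma IsCoherentUtility.isConditionalUtility_lift (hu : IsCoherentUtility P m₁ m₂ u)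
    (h₁₂ : m₁ ≤ m₂) (h₂ : m₂ ≤ m₀) : IsConditionalUtility P m₁ m₂ (lift u) := by
  have h₁ := h₁₂.trans h₂
  have homog : ∀ {l f : Ω → ℝ}, BddMeas m₁ l → BddMeas m₂ f → (∀ ω, 0 ≤ l ω) →
      ∀ᵐ ω ∂P, lift u (fun ω => l ω * f ω) ω = l ω * lift u f ω := by
    intro l f hl hf hl0
    have hlf := (hl.mono h₁₂).mul hf
    have h := hu.pos_homogeneous (ofFun P m₂ f) (ofFun P m₂ fun ω => l ω * f ω) (ofFun P m₁ l)
      (by filter_upwards [coe_ofFun h₁ hl] with ω h; rw [h]; exact hl0 ω)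
      (by
        filter_upwards [coe_ofFun h₁ hl, coe_ofFun h₂ hf, coe_ofFun h₂ hlf] with ω h1 h2 h3
        rw [h1, h2, h3])
    filter_upwards [h, coe_ofFun h₁ hl, coe_ae_eq_lift u f,
      coe_ae_eq_lift u fun ω => l ω * f ω] with ω h1 h2 h3 h4
    rw [← h4, h1, h2, h3]
  have superadd : ∀ {f g : Ω → ℝ}, BddMeas m₂ f → BddMeas m₂ g →
      ∀ᵐ ω ∂P, lift u f ω + lift u g ω ≤ lift u (fun ω => f ω + g ω) ω := by
    intro f g hf hg
    have hc : BddMeas m₁ (fun _ : Ω => (1 / 2 : ℝ)) := BddMeas.const (1 / 2)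
    have hfg := (hc.mono h₁₂).mul (hf.add hg)
    have h := hu.concave (ofFun P m₂ f) (ofFun P m₂ g)
      (ofFun P m₂ fun ω => 1 / 2 * (f ω + g ω)) (ofFun P m₁ fun _ => 1 / 2)
      (by filter_upwards [coe_ofFun h₁ hc] with ω h; rw [h]; norm_num)
      (by
        filter_upwards [coe_ofFun h₁ hc, coe_ofFun h₂ hf, coe_ofFun h₂ hg, coe_ofFun h₂ hfg]
          with ω h1 h2 h3 h4
        rw [h1, h2, h3, h4]
        ring)
    filter_upwards [h, homog hc (hf.add hg) (fun _ => by norm_num), coe_ofFun h₁ hc,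
      coe_ae_eq_lift u f, coe_ae_eq_lift u g, coe_ae_eq_lift u fun ω => 1 / 2 * (f ω + g ω)]
      with ω h1 h2 h3 h4 h5 h6
    rw [h3, h4, h5, h6, h2] at h1
    linarith
  refine ⟨fun _ => lift_bddMeas _ _, fun {f g} hf hg hfg => ?_, superadd, homog,
    fun {f a} hf ha => ?_⟩
  · have hgf := hg.sub hf
    have h := hu.nonneg (ofFun P m₂ fun ω => g ω - f ω) (by
      filter_upwards [coe_ofFun h₂ hgf, hfg] with ω h1 h2
      rw [h1]
      exact sub_nonneg.2 h2)
    have h' := superadd hf hgf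
    simp only [add_sub_cancel] at h'
    filter_upwards [h, h', coe_ae_eq_lift u fun ω => g ω - f ω] with ω h1 h2 h3
    rw [h3] at h1
    linarith
  · have hfa := hf.add (ha.mono h₁₂)
    have h := hu.translation (ofFun P m₂ f) (ofFun P m₂ fun ω => f ω + a ω) (ofFun P m₁ a) (by
      filter_upwards [coe_ofFun h₁ ha, coe_ofFun h₂ hf, coe_ofFun h₂ hfa] with ω h1 h2 h3
      rw [h1, h2, h3])
    filter_upwards [h, coe_ofFun h₁ ha, coe_ae_eq_lift u f,
      coe_ae_eq_lift u fun ω => f ω + a ω] with ω h1 h2 h3 h4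
    rw [← h4, h1, h2, h3]

/-- Random variables that are measurable for a trivial σ-algebra are almost surely constant. -/
lemma ae_eq_integral_of_trivial {m : MeasurableSpace Ω} (hm : m ≤ m₀)
    (htriv : ∀ A, MeasurableSet[m] A → P A = 0 ∨ P A = 1) {f : Ω → ℝ} (hf : BddMeas m f) :
    ∀ᵐ ω ∂P, f ω = ∫ x, f x ∂P := by
  -- A trivial σ-algebra is independent of itself, so f = E[f | m] = E[f].
  have hind : Indep m m P := by
    refine (Indep_iff m m P).2 fun A B hA hB => ?_
    rcases htriv A hA with h | h
    · rw [h, zero_mul]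
      exact measure_mono_null Set.inter_subset_left h
    · rw [h, one_mul]
      have hc : P Aᶜ = 0 := (prob_compl_eq_zero_iff (hm _ hA)).2 h
      refine measure_congr ?_
      filter_upwards [measure_eq_zero_iff_ae_notMem.1 hc] with ω hω
      have : ω ∈ A := not_not.1 hω
      exact propext ⟨fun h => h.2, fun h => ⟨this, h⟩⟩
  have h1 := condExp_indep_eq hm hm hf.1.stronglyMeasurable hind
  rwa [condExp_of_stronglyMeasurable hm hf.1.stronglyMeasurable (hf.integrable hm)] at h1

lemma tendsto_of_tendstoInMeasure_const {c : ℕ → ℝ} {a : ℝ}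
    (h : TendstoInMeasure P (fun n (_ : Ω) => c n) atTop fun _ => a) :
    Tendsto c atTop (𝓝 a) := by
  refine EMetric.tendsto_nhds.2 fun ε hε => ?_
  filter_upwards [(h ε hε).eventually (gt_mem_nhds zero_lt_one)] with n hn
  by_contra hlt
  rw [not_lt] at hlt
  have : {x : Ω | ε ≤ edist (c n) a} = Set.univ := Set.eq_univ_of_forall fun _ => hlt
  rw [this, measure_univ] at hn
  exact lt_irrefl _ hn

/-- The integral merely reads off the a.s. constant value of the lift, so each almost sure relation
becomes one between numbers at a suitable point ω. -/
lemma IsCoherentUtility.isUtilityFunctional_lift (hu : IsCoherentUtility P m₁ m₂ u)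
    (h₁₂ : m₁ ≤ m₂) (h₂ : m₂ ≤ m₀) (htriv : ∀ A, MeasurableSet[m₁] A → P A = 0 ∨ P A = 1)
    (hrel : IsRelevant P m₁ m₂ u) (hleb : IsLebesgueContinuous P m₁ m₂ u)
    (hcom : IsCommonotone P m₁ m₂ u) :
    IsUtilityFunctional P m₂ fun f => ∫ ω, lift u f ω ∂P := by
  have hv := hu.isConditionalUtility_lift h₁₂ h₂
  have hconst : ∀ f, ∀ᵐ ω ∂P, lift u f ω = ∫ x, lift u f x ∂P := fun f =>
    ae_eq_integral_of_trivial (h₁₂.trans h₂) htriv (lift_bddMeas _ _)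
  constructor
  · intro f g hf hg h
    obtain ⟨ω, h1, h2, h3⟩ := ((hv.mono hf hg h).and ((hconst f).and (hconst g))).exists
    rw [← h2, ← h3]
    exact h1
  · intro f g hf hg
    obtain ⟨ω, h1, h2, h3, h4⟩ := ((hv.superadd hf hg).and
      ((hconst f).and ((hconst g).and (hconst _)))).exists
    rw [← h2, ← h3, ← h4]
    exact h1
  · intro c f hc hf
    obtain ⟨ω, h1, h2, h3⟩ := ((hv.homog (BddMeas.const c) hf fun _ => hc).and
      ((hconst f).and (hconst _))).exists
    rw [← h2, ← h3]
    exact h1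
  · intro f a hf
    obtain ⟨ω, h1, h2, h3⟩ := ((hv.translation hf (BddMeas.const a)).and
      ((hconst f).and (hconst _))).exists
    rw [← h2, ← h3]
    exact h1
  · intro A hA hpos
    have h := hrel A hA hpos _ (coe_ofFun h₂ (BddMeas.ind hA).neg)
    obtain ⟨ω, h1, h2, h3⟩ := (h.and ((coe_ae_eq_lift u _).and (hconst _))).exists
    rw [← h3, ← h2]
    exact h1
  · intro f g hf hg hb hlim
    obtain ⟨C, hC⟩ := hb
    have h := hleb (fun n => ofFun P m₂ (f n)) (ofFun P m₂ g)
      ⟨C, fun n => by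
        filter_upwards [coe_ofFun h₂ (hf n)] with ω h1
        rw [h1]
        exact hC n ω⟩
      ((tendstoInMeasure_of_tendsto_ae
        (fun n => ((hf n).integrable h₂).aestronglyMeasurable) hlim).congr
        (fun n => (coe_ofFun h₂ (hf n)).symm) (coe_ofFun h₂ hg).symm)
    exact tendsto_of_tendstoInMeasure_const (P := P) (h.congr
      (fun n => (coe_ae_eq_lift u _).trans (hconst _)) ((coe_ae_eq_lift u _).trans (hconst _)))
  · intro A B hA hB hAB
    have hmA := BddMeas.ind hA
    have hmB := BddMeas.ind hB
    have hCom : Commonotone P m₂ (ofFun P m₂ (ind A)) (ofFun P m₂ (ind B)) := by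
      -- Since A ⊆ B, the sum 1_A + 1_B takes the values 0, 1, 2; the thresholds 2 and 1 recover 1_A
      -- and 1_B.
      refine ⟨fun x => if 2 ≤ x then 1 else 0, fun x => if 1 ≤ x then 1 else 0,
        fun ω => ind A ω + ind B ω, ?_, ?_, (hmA.add hmB).1, ?_, ?_⟩
      · intro x y hxy
        dsimp only
        split_ifs <;> linarith
      · intro x y hxy
        dsimp only
        split_ifs <;> linarith
      · filter_upwards [coe_ofFun h₂ hmA] with ω h1
        rw [h1]
        by_cases h2 : ω ∈ A
        · norm_num [h2, hAB h2]
        · by_cases h3 : ω ∈ B <;> norm_num [h2, h3]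
      · filter_upwards [coe_ofFun h₂ hmB] with ω h1
        rw [h1]
        by_cases h2 : ω ∈ A
        · norm_num [h2, hAB h2]
        · by_cases h3 : ω ∈ B <;> norm_num [h2, h3]
    have h := hcom _ _ hCom
    have hsum : ofFun P m₂ (fun ω => ind A ω + ind B ω) =
        ofFun P m₂ (ind A) + ofFun P m₂ (ind B) := by
      refine ofFun_eq ?_
      rw [Submodule.coe_add]
      filter_upwards [Lp.coeFn_add (ofFun P m₂ (ind A) : Lp ℝ ∞ P) (ofFun P m₂ (ind B)),
        coe_ofFun h₂ hmA, coe_ofFun h₂ hmB] with ω h1 h2 h3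
      rw [h1, Pi.add_apply, h2, h3]
    rw [← hsum] at h
    have h' : (u (ofFun P m₂ fun ω => ind A ω + ind B ω) : Lp ℝ ∞ P) =ᵐ[P]
        (u (ofFun P m₂ (ind A)) : Lp ℝ ∞ P) + (u (ofFun P m₂ (ind B)) : Lp ℝ ∞ P) := by
      rw [h, Submodule.coe_add]
      exact Lp.coeFn_add _ _
    obtain ⟨ω, h1, h2, h3, h4, h5, h6, h7⟩ := (h'.and ((coe_ae_eq_lift u _).and
      ((coe_ae_eq_lift u (ind A)).and ((coe_ae_eq_lift u (ind B)).and
        ((hconst (ind A)).and ((hconst (ind B)).and (hconst _))))))).exists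
    rw [← h5, ← h6, ← h3, ← h4, ← Pi.add_apply, ← h1, h2, h7]

/-- Translation from 0 shows that `w` fixes `m₂`-measurable classes; hence composing with `w` once
more changes nothing. This yields φ(f) = φ(v f). -/
lemma IsCoherentUtility.lift_comp {m₃ : MeasurableSpace Ω} {w : LInfty P m₃ → LInfty P m₂}
    (hw : IsCoherentUtility P m₂ m₃ w) (h₂₃ : m₂ ≤ m₃) (h₃ : m₃ ≤ m₀) (f : Ω → ℝ) :
    lift (u ∘ w) f = lift (u ∘ w) (lift w f) := by
  have hX := rep_bddMeas (w (ofFun P m₃ f))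
  have key : w (ofFun P m₃ (lift w f)) = w (ofFun P m₃ f) := by
    refine LInfty.ext ?_
    have h := hw.translation 0 (ofFun P m₃ (lift w f)) (w (ofFun P m₃ f)) (by
      filter_upwards [coe_ofFun h₃ (hX.mono h₂₃), coe_ae_eq_lift w f, Lp.coeFn_zero ℝ ∞ P]
        with ω h1 h2 h3
      rw [Submodule.coe_zero, h3, h2, lift, h1, Pi.zero_apply, zero_add])
    rw [hw.map_zero] at h
    filter_upwards [h, Lp.coeFn_zero ℝ ∞ P] with ω h1 h2
    rw [h1, Submodule.coe_zero, h2, Pi.zero_apply, zero_add]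
  unfold lift at key ⊢
  rw [Function.comp_apply, Function.comp_apply, key]

end Transfer

/-! ### The main theorem -/

theorem mainTheorem2 {Ω : Type*} {m₀ : MeasurableSpace Ω} (P : Measure Ω)
    [IsProbabilityMeasure P] (T : ℝ) (hT : 0 < T)
    (ℱ : Filtration (Set.Icc (0 : ℝ) T) m₀)
    (hℱ₀ : ∀ A : Set Ω, MeasurableSet[ℱ ⟨0, le_refl 0, hT.le⟩] A → P A = 0 ∨ P A = 1)
    (hℱT : ℱ ⟨T, hT.le, le_refl T⟩ =
      ⨆ (t : Set.Icc (0 : ℝ) T) (_ : (t : ℝ) < T), ℱ t)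
    (u : ∀ t s : Set.Icc (0 : ℝ) T, t ≤ s → LInfty P (ℱ s) → LInfty P (ℱ t))
    (hcoh : ∀ (t s : Set.Icc (0 : ℝ) T) (hts : t ≤ s),
      IsCoherentUtility P (ℱ t) (ℱ s) (u t s hts))
    (hcons : ∀ (t s v : Set.Icc (0 : ℝ) T) (hts : t ≤ s) (hsv : s ≤ v),
      u t v (hts.trans hsv) = u t s hts ∘ u s v hsv)
    (hatomless : ∀ t : Set.Icc (0 : ℝ) T, (t : ℝ) < T →
      CondAtomless P (ℱ t) (ℱ ⟨T, hT.le, le_refl T⟩))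
    (hrel : IsRelevant P (ℱ ⟨0, le_refl 0, hT.le⟩) (ℱ ⟨T, hT.le, le_refl T⟩)
      (u ⟨0, le_refl 0, hT.le⟩ ⟨T, hT.le, le_refl T⟩ hT.le))
    (hleb : IsLebesgueContinuous P (ℱ ⟨0, le_refl 0, hT.le⟩) (ℱ ⟨T, hT.le, le_refl T⟩)
      (u ⟨0, le_refl 0, hT.le⟩ ⟨T, hT.le, le_refl T⟩ hT.le))
    (hcom : IsCommonotone P (ℱ ⟨0, le_refl 0, hT.le⟩) (ℱ ⟨T, hT.le, le_refl T⟩)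
      (u ⟨0, le_refl 0, hT.le⟩ ⟨T, hT.le, le_refl T⟩ hT.le)) :
    ∃ Q : Measure Ω, IsProbabilityMeasure Q ∧ Q ≪ P ∧ P ≪ Q ∧
      ∀ ξ : LInfty P (ℱ ⟨T, hT.le, le_refl T⟩),
        ∀ᵐ ω ∂P, (u ⟨0, le_refl 0, hT.le⟩ ⟨T, hT.le, le_refl T⟩ hT.le ξ : Lp ℝ ∞ P) ω
          = ∫ x, (ξ : Lp ℝ ∞ P) x ∂Q := by
  set t₀ : Set.Icc (0 : ℝ) T := ⟨0, le_refl 0, hT.le⟩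
  set t₁ : Set.Icc (0 : ℝ) T := ⟨T, hT.le, le_refl T⟩
  have h01 : t₀ ≤ t₁ := hT.le
  have hφ := (hcoh t₀ t₁ h01).isUtilityFunctional_lift (ℱ.mono h01) (ℱ.le t₁) hℱ₀ hrel hleb hcom
  set φ : (Ω → ℝ) → ℝ := fun f => ∫ ω, LInfty.lift (u t₀ t₁ h01) f ω ∂P with hφdef
  have hgen : ℱ t₁ = MeasurableSpace.generateFrom
      {A | ∃ t : Set.Icc (0 : ℝ) T, (t : ℝ) < T ∧ MeasurableSet[ℱ t] A} := by
    refine le_antisymm ?_ ?_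
    · rw [hℱT]
      exact iSup₂_le fun t ht A hA => MeasurableSpace.measurableSet_generateFrom ⟨t, ht, hA⟩
    · refine MeasurableSpace.generateFrom_le ?_
      rintro A ⟨t, ht, hA⟩
      exact ℱ.mono (show t ≤ t₁ from t.2.2) A hA
  -- Any two sets of the union lie in a common F_t with t < T, as the filtration is increasing.
  have hpi : IsPiSystem {A | ∃ t : Set.Icc (0 : ℝ) T, (t : ℝ) < T ∧ MeasurableSet[ℱ t] A} := by
    rintro A ⟨t, ht, hA⟩ B ⟨s, hs, hB⟩ -
    rcases le_total t s with h | h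
    · exact ⟨s, hs, (ℱ.mono h A hA).inter hB⟩
    · exact ⟨t, ht, hA.inter (ℱ.mono h B hB)⟩
  have hsymm : ∀ A, MeasurableSet[ℱ t₁] A → φ (ind A) + φ (fun ω => -ind A ω) = 0 := by
    refine fun A hA => hφ.symm_of_generateFrom hgen hpi ?_ hA
    rintro A ⟨t, ht, hA⟩
    have h0t : t₀ ≤ t := t.2.1
    have ht1 : t ≤ t₁ := t.2.2
    have hcomp : ∀ f, BddMeas (ℱ t₁) f → φ f = φ (LInfty.lift (u t t₁ ht1) f) := by
      intro f _
      have h := (hcoh t t₁ ht1).lift_comp (u := u t₀ t h0t) (ℱ.mono ht1) (ℱ.le t₁) f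
      rw [← hcons t₀ t t₁ h0t ht1] at h
      simp only [hφdef]
      exact congrArg (fun g : Ω → ℝ => ∫ ω, g ω ∂P) h
    have hone := map_ind_add_map_ind_compl
      ((hcoh t t₁ ht1).isConditionalUtility_lift (ℱ.mono ht1) (ℱ.le t₁)) (ℱ.mono ht1)
      (ℱ.le t₁) hφ hcomp (hatomless t ht) hA
    have hA₁ : MeasurableSet[ℱ t₁] Aᶜ := (ℱ.mono ht1 A hA).compl
    -- Shifting 1_{Aᶜ} by -1 gives -1_A, which turns φ(1_A) + φ(1_{Aᶜ}) = 1 into symmetry.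
    have h := hφ.translation (-1) (BddMeas.ind hA₁)
    have heq : (fun ω => ind Aᶜ ω + -1) = fun ω => -ind A ω := by
      ext ω
      by_cases hω : ω ∈ A <;> simp [hω]
    rw [heq] at h
    linarith
  obtain ⟨Q, hQ, hQP, hPQ, hint⟩ := hφ.exists_measure (ℱ.le t₁) hsymm
  refine ⟨Q, hQ, hQP, hPQ, fun ξ => ?_⟩
  have hξ := LInfty.coe_ae_eq_rep ξ
  have h1 := LInfty.coe_ae_eq_lift (u t₀ t₁ h01) (LInfty.rep ξ)
  rw [LInfty.ofFun_eq hξ] at h1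
  have h2 := ae_eq_integral_of_trivial (ℱ.le t₀) hℱ₀
    (LInfty.lift_bddMeas (u t₀ t₁ h01) (LInfty.rep ξ))
  filter_upwards [h1, h2] with ω h3 h4
  rw [h3, h4, integral_congr_ae (hQP.ae_le hξ)]
  exact hint _ (LInfty.rep_bddMeas ξ)
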